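/- **Setting.** A quantum system is a complex Hilbert space $\mathcal H$ of arbitrary dimension; composite systems are Hilbert space tensor products, with $\mathcal H^{\otimes 0}=\mathbb C$. A state on $\mathcal H$ is a positive trace-class operator of trace one. A channel is a completely positive trace-preserving linear map between spaces of trace-class operators. A quantum resource theory (QRT) assigns to every system $\mathcal H$ a set of states $\mathcal S(\mathcal H)$ that is compact in the trace norm, and to every pair of systems a set $\mathcal O(\mathcal H\to\mathcal H')$ of channels that is compact in the bounded weak topology. The elements of $\mathcal O(\mathcal H\to\mathcal H')$ are called free operations; they map $\mathcal S(\mathcal H)$ into $\mathcal S(\mathcal H')$. The free operations are closed under composition and tensor products, and contain the identity of every system and the trace $\mathcal H\to\mathbb C$ (with the usual identifications of $(\mathcal H_1\otimes\mathcal H_2)\otimes\mathcal H_3$ with $\mathcal H_1\otimes(\mathcal H_2\otimes\mathcal H_3)$ and of $\mathbb C\otimes\mathcal H$ and $\mathcal H\otimes\mathbb C$ with $\mathcal H$). A state $\phi\in\mathcal S(\mathcal H)$ is *maximally resourceful*, written $\phi\in\mathcal G(\mathcal H)$, if for every $\psi\in\mathcal S(\mathcal H)$ that some free operation in $\mathcal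 O(\mathcal H\to\mathcal H)$ maps to $\phi$, some free operation in $\mathcal O(\mathcal H\to\mathcal H)$ maps $\phi$ to $\psi$. For $\phi\in\mathcal S(\mathcal H_1)$ and $\psi\in\mathcal S(\mathcal H_2)$, the *conversion rate* $r_{\rm conv}(\phi\to\psi)\in[0,\infty]$ is the supremum of all $r\ge 0$ for which there are free operations $\mathcal N_n\in\mathcal O(\mathcal H_1^{\otimes n}\to\mathcal H_2^{\otimes\lceil rn\rceil})$, $n\in\mathbb N$, with $$\liminf_{n\to\infty}\bigl\|\mathcal N_n(\phi^{\otimes n})-\psi^{\otimes\lceil rn\rceil}\bigr\|_1=0 .$$ For a normalization constant $R_{\max}^{(\mathcal H)}\in[0,\infty)$ and $\psi\in\mathcal S(\mathcal H)$, the *distillable resource* and the *resource cost* are $$R_{\rm D}(\psi)=\inf_{\phi\in\mathcal S(\mathcal H)} r_{\rm conv}(\psi\to\phi)\,R_{\max}^{(\mathcal H)},\qquad R_{\rm C}(\psi)=\inf_{\phi\in\mathcal S(\mathcal H)}\frac{R_{\max}^{(\mathcal H)}}{r_{\rm conv}(\phi\to\psi)},$$ with values in $[0,\infty]$ and the conventions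 $0\cdot\infty=0$, $c/0=\infty$ for $c>0$, $0/0=0$ and $c/\infty=0$. A *resource measure* is a family of functions $R_{\mathcal H}:\mathcal S(\mathcal H)\to\mathbb R$, one for each system, with $R_{\mathcal H'}(\mathcal N(\psi))\le R_{\mathcal H}(\psi)$ for all $\psi\in\mathcal S(\mathcal H)$ and $\mathcal N\in\mathcal O(\mathcal H\to\mathcal H')$. It is *consistent* if $R_{\mathcal H}(\psi)\,r_{\rm conv}(\phi\to\psi)\le R_{\mathcal H'}(\phi)$ for all systems $\mathcal H,\mathcal H'$ and all $\psi\in\mathcal S(\mathcal H)$, $\phi\in\mathcal S(\mathcal H')$. **Statement.** Let $R$ be a consistent resource measure of a QRT, let $\mathcal H$ be a system and let $R_{\max}^{(\mathcal H)}\ge 0$. Suppose that $0\le R_{\mathcal H}(\psi)\le R_{\max}^{(\mathcal H)}$ for every $\psi\in\mathcal S(\mathcal H)$, and that there is $\phi\in\mathcal G(\mathcal H)$ with $R_{\mathcal H}(\phi)=R_{\max}^{(\mathcal H)}$. Then, for every $\psi\in\mathcal S(\mathcal H)$, $$R_{\rm D}(\psi)\le R_{\mathcal H}(\psi)\le R_{\rm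 C}(\psi).$$ -/

import Mathlib

universe u v

noncomputable section

namespace ResourceTheory

open scoped ENNReal NNReal TensorProduct InnerProductSpace ComplexOrder
open Filter

set_option linter.unusedSectionVars false

/-! ### Trace, trace norm and trace-class operators on a complex Hilbert space -/

section TraceClass
variable {H K : Type*} [NormedAddCommGroup H] [InnerProductSpace ℂ H] [CompleteSpace H]
  [NormedAddCommGroup K] [InnerProductSpace ℂ K] [CompleteSpace K]

variable (H) in
/-- Index set of a fixed orthonormal basis of `H` (of arbitrary cardinality). -/
def stdIndex : Set H := (exists_hilbertBasis ℂ H).choose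

variable (H) in
/-- A fixed orthonormal basis of `H`. -/
def stdBasis : HilbertBasis (stdIndex H) ℂ H := (exists_hilbertBasis ℂ H).choose_spec.choose

/-- The trace `tr T = ∑ₖ ⟨k|T|k⟩`, the (unconditional) sum over an orthonormal basis. -/
def opTrace (T : H →L[ℂ] H) : ℂ := ∑' i, ⟪stdBasis H i, T (stdBasis H i)⟫_ℂ

/-- The trace norm `‖T‖₁ = tr |T|` with `|T| = √(T† T)`, as an extended nonnegative number. -/
def traceNorm (T : H →L[ℂ] H) : ℝ≥0∞ :=
  ∑' i, ENNReal.ofReal (⟪stdBasis H i, CFC.abs T (stdBasis H i)⟫_ℂ).re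

theorem hilbert_parseval {ι : Type*} (b : HilbertBasis ι ℂ H) (x : H) :
    ∑' i, ‖⟪b i, x⟫_ℂ‖ₑ ^ 2 = ‖x‖ₑ ^ 2 := by
  have h := b.hasSum_inner_mul_inner x x
  have h2 : HasSum (fun i => ‖⟪b i, x⟫_ℂ‖ ^ 2) (‖x‖ ^ 2) := by
    have h3 := Complex.hasSum_re h
    rw [inner_self_eq_norm_sq_to_K] at h3
    convert h3 using 1
    · ext i
      rw [← inner_conj_symm x (b i), RCLike.conj_mul]
      norm_cast
    · norm_cast
  have e : ∀ y : ℂ, ‖y‖ₑ ^ 2 = ENNReal.ofReal (‖y‖ ^ 2) := fun y => by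
    rw [← ofReal_norm, ENNReal.ofReal_pow (norm_nonneg _)]
  have e' : ‖x‖ₑ ^ 2 = ENNReal.ofReal (‖x‖ ^ 2) := by
    rw [← ofReal_norm, ENNReal.ofReal_pow (norm_nonneg _)]
  simp_rw [e, e']
  rw [← h2.tsum_eq, ENNReal.ofReal_tsum_of_nonneg (fun _ => by positivity) h2.summable]

theorem hs_adjoint {ι κ : Type*} (b : HilbertBasis ι ℂ H) (c : HilbertBasis κ ℂ K)
    (A : H →L[ℂ] K) :
    ∑' i, ‖A (b i)‖ₑ ^ 2 = ∑' j, ‖A.adjoint (c j)‖ₑ ^ 2 := by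
  simp_rw [← hilbert_parseval c (A _), ← hilbert_parseval b (A.adjoint _)]
  rw [ENNReal.tsum_comm]
  refine tsum_congr fun j => tsum_congr fun i => ?_
  rw [ContinuousLinearMap.adjoint_inner_right, ← inner_conj_symm, ← ofReal_norm, RCLike.norm_conj,
    ofReal_norm]

theorem hs_basis {ι κ : Type*} (b : HilbertBasis ι ℂ H) (c : HilbertBasis κ ℂ H)
    (A : H →L[ℂ] H) :
    ∑' i, ‖A (b i)‖ₑ ^ 2 = ∑' j, ‖A (c j)‖ₑ ^ 2 := by
  rw [hs_adjoint b b A, hs_adjoint c b A]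

theorem hs_mul_le {ι : Type*} (b : HilbertBasis ι ℂ H) (A W : H →L[ℂ] H) (hW : ‖W‖ ≤ 1) :
    ∑' i, ‖(A * W) (b i)‖ₑ ^ 2 ≤ ∑' i, ‖A (b i)‖ₑ ^ 2 := by
  rw [hs_adjoint b b, hs_adjoint b b A]
  refine ENNReal.tsum_le_tsum fun i => ?_
  gcongr
  have : (A * W).adjoint = W.adjoint ∘L A.adjoint := ContinuousLinearMap.adjoint_comp A W
  rw [this, enorm_le_iff_norm_le]
  refine (W.adjoint.le_opNorm _).trans ?_
  have : ‖W.adjoint‖ ≤ 1 := by simpa using hW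
  exact mul_le_of_le_one_left (norm_nonneg _) this

theorem inner_nonneg_op {P : H →L[ℂ] H} (hP : 0 ≤ P) (x : H) :
    ENNReal.ofReal (⟪x, P x⟫_ℂ).re = ‖CFC.sqrt P x‖ₑ ^ 2 := by
  have hs : IsSelfAdjoint (CFC.sqrt P) := IsSelfAdjoint.of_nonneg (CFC.sqrt_nonneg P)
  have h : CFC.sqrt P * CFC.sqrt P = P := CFC.sqrt_mul_sqrt_self P
  have : ⟪x, P x⟫_ℂ = ⟪CFC.sqrt P x, CFC.sqrt P x⟫_ℂ := by
    conv_lhs => rw [← h, ← hs.adjoint_eq]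
    rw [hs.adjoint_eq]
    conv_lhs => rw [← hs.adjoint_eq]
    rw [mul_apply_eq_comp, ContinuousLinearMap.adjoint_inner_right, hs.adjoint_eq]
  rw [this, inner_self_eq_norm_sq_to_K, ← ofReal_norm, ← ENNReal.ofReal_pow (norm_nonneg _)]
  norm_cast

/-- The trace of a positive operator does not depend on the orthonormal basis. -/
theorem posTrace_basis {ι κ : Type*} (b : HilbertBasis ι ℂ H) (c : HilbertBasis κ ℂ H)
    {P : H →L[ℂ] H} (hP : 0 ≤ P) :
    ∑' i, ENNReal.ofReal (⟪b i, P (b i)⟫_ℂ).re = ∑' j, ENNReal.ofReal (⟪c j, P (c j)⟫_ℂ).re := by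
  simp_rw [inner_nonneg_op hP]
  exact hs_basis b c _

theorem norm_abs_apply (T : H →L[ℂ] H) (x : H) : ‖CFC.abs T x‖ = ‖T x‖ := by
  have hs : IsSelfAdjoint (CFC.abs T) := IsSelfAdjoint.of_nonneg (CFC.abs_nonneg T)
  have h : CFC.abs T * CFC.abs T = star T * T := CFC.abs_mul_abs T
  have h1 : ⟪CFC.abs T x, CFC.abs T x⟫_ℂ = ⟪T x, T x⟫_ℂ := by
    rw [← ContinuousLinearMap.adjoint_inner_right, hs.adjoint_eq, ← mul_apply_eq_comp,
      h, mul_apply_eq_comp, ContinuousLinearMap.star_eq_adjoint,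
      ContinuousLinearMap.adjoint_inner_right]
  rw [inner_self_eq_norm_sq_to_K, inner_self_eq_norm_sq_to_K] at h1
  have : ‖CFC.abs T x‖ ^ 2 = ‖T x‖ ^ 2 := by exact_mod_cast h1
  exact (sq_eq_sq₀ (norm_nonneg _) (norm_nonneg _)).1 this

/-- Polar decomposition, needed for the triangle inequality of the trace norm. -/
theorem exists_polar (T : H →L[ℂ] H) :
    ∃ V : H →L[ℂ] H, ‖V‖ ≤ 1 ∧ V * CFC.abs T = T ∧ V.adjoint * T = CFC.abs T := by
  set A := CFC.abs T with hA
  set M : Submodule ℂ H := (LinearMap.range (A : H →ₗ[ℂ] H)).topologicalClosure with hM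
  have hmem : ∀ x, A x ∈ M := fun x => Submodule.le_topologicalClosure _ ⟨x, rfl⟩
  have : CompleteSpace M := (Submodule.isClosed_topologicalClosure _).completeSpace_coe
  let e : H →ₗ[ℂ] M := (A : H →ₗ[ℂ] H).codRestrict M hmem
  have hd : DenseRange e := by
    have : Dense (((↑) : M → H) ⁻¹' (Set.range A)) := by
      rw [Subtype.dense_iff]
      intro x hx
      have h2 : ((↑) : M → H) '' (((↑) : M → H) ⁻¹' (Set.range A)) = Set.range A := by
        rw [Set.image_preimage_eq_inter_range, Set.inter_eq_left]
        rintro _ ⟨y, rfl⟩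
        exact ⟨⟨A y, hmem y⟩, rfl⟩
      have hx' : x ∈ closure (Set.range A) := hx
      rw [← h2] at hx'
      exact hx'
    refine this.mono ?_
    rintro ⟨x, hx⟩ ⟨y, hy⟩
    exact ⟨y, Subtype.ext hy⟩
  have hn : ∀ x, ‖(T : H →ₗ[ℂ] H) x‖ ≤ 1 * ‖e x‖ := fun x => by
    rw [one_mul]
    exact (norm_abs_apply T x).ge
  let V₀ : M →L[ℂ] H := (T : H →ₗ[ℂ] H).extendOfNorm e
  have hV₀ : ∀ x, V₀ (e x) = T x := fun x => LinearMap.extendOfNorm_eq hd ⟨1, hn⟩ x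
  have hV₀n : ‖V₀‖ ≤ 1 := LinearMap.opNorm_extendOfNorm_le hd zero_le_one hn
  let P : H →L[ℂ] M := M.orthogonalProjectionOnto
  have hP : ∀ x, P (A x) = e x := fun x =>
    Submodule.orthogonalProjectionOnto_mem_subspace_eq_self (⟨A x, hmem x⟩ : M)
  have hiso : ∀ m : M, ‖V₀ m‖ = ‖m‖ := by
    intro m
    refine hd.induction_on m (isClosed_eq (by fun_prop) (by fun_prop)) fun x => ?_
    rw [hV₀]
    exact (norm_abs_apply T x).symm
  let V₁ : M →ₗᵢ[ℂ] H := ⟨V₀, hiso⟩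
  have hVA : (V₀ ∘L P) * A = T := by
    ext x
    change V₀ (P (A x)) = T x
    rw [hP, hV₀]
  refine ⟨V₀ ∘L P, ?_, hVA, ?_⟩
  · refine (ContinuousLinearMap.opNorm_comp_le _ _).trans ?_
    have := M.orthogonalProjectionOnto_norm_le
    exact mul_le_one₀ hV₀n (norm_nonneg _) this
  · ext x
    refine ext_inner_right ℂ fun y => ?_
    rw [mul_apply_eq_comp, ContinuousLinearMap.adjoint_inner_left, ← hV₀ x]
    change ⟪V₁ (e x), V₁ (P y)⟫_ℂ = _
    rw [V₁.inner_map_map]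
    exact Submodule.inner_orthogonalProjectionOnto_eq_of_mem_left (e x) y

theorem tsum_enorm_inner_le {ι : Type*} (b : HilbertBasis ι ℂ H) (W T : H →L[ℂ] H)
    (hW : ‖W‖ ≤ 1) : ∑' i, ‖⟪b i, (W * T) (b i)⟫_ℂ‖ₑ ≤ traceNorm T := by
  obtain ⟨V, hV, hVT, -⟩ := exists_polar T
  set A := CFC.abs T with hA
  have hA0 : 0 ≤ A := CFC.abs_nonneg T
  set B := CFC.sqrt A with hB
  have hs : IsSelfAdjoint B := IsSelfAdjoint.of_nonneg (CFC.sqrt_nonneg A)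
  have hBB : B * B = A := CFC.sqrt_mul_sqrt_self A
  set U := (W * V).adjoint with hU
  have hUn : ‖U‖ ≤ 1 := by
    rw [hU, LinearIsometryEquiv.norm_map]
    exact (norm_mul_le _ _).trans (mul_le_one₀ hW (norm_nonneg _) hV)
  have key : ∀ x, ⟪x, (W * T) x⟫_ℂ = ⟪(B * U) x, B x⟫_ℂ := by
    intro x
    have : W * T = U.adjoint * (B.adjoint * B) := by
      rw [hs.adjoint_eq, hBB, hU, ContinuousLinearMap.adjoint_adjoint, mul_assoc, hVT]
    rw [this]
    simp only [mul_apply_eq_comp]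
    rw [ContinuousLinearMap.adjoint_inner_right, ContinuousLinearMap.adjoint_inner_right]
  have hsum : ∑' i, ‖B (b i)‖ₑ ^ 2 = traceNorm T := by
    rw [traceNorm, ← hA, posTrace_basis _ b hA0]
    simp_rw [inner_nonneg_op hA0]
    rfl
  have young : ∀ s t : ℝ≥0∞, 2 * (s * t) ≤ s ^ 2 + t ^ 2 := by
    intro s t
    rcases eq_or_ne s ∞ with rfl | hs
    · simp
    rcases eq_or_ne t ∞ with rfl | ht
    · simp
    lift s to ℝ≥0 using hs
    lift t to ℝ≥0 using ht
    norm_cast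
    rw [← mul_assoc]
    exact two_mul_le_add_sq s t
  have h2 : 2 * ∑' i, ‖⟪b i, (W * T) (b i)⟫_ℂ‖ₑ ≤ 2 * traceNorm T := by
    calc 2 * ∑' i, ‖⟪b i, (W * T) (b i)⟫_ℂ‖ₑ
        = ∑' i, 2 * ‖⟪b i, (W * T) (b i)⟫_ℂ‖ₑ := ENNReal.tsum_mul_left.symm
      _ ≤ ∑' i, (‖(B * U) (b i)‖ₑ ^ 2 + ‖B (b i)‖ₑ ^ 2) := by
          refine ENNReal.tsum_le_tsum fun i => le_trans ?_ (young _ _)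
          gcongr
          rw [key, ← ofReal_norm, ← ofReal_norm, ← ofReal_norm,
            ← ENNReal.ofReal_mul (norm_nonneg _)]
          exact ENNReal.ofReal_le_ofReal (norm_inner_le_norm _ _)
      _ = ∑' i, ‖(B * U) (b i)‖ₑ ^ 2 + ∑' i, ‖B (b i)‖ₑ ^ 2 := ENNReal.tsum_add
      _ ≤ traceNorm T + traceNorm T := by
          rw [hsum]
          gcongr
          exact (hs_mul_le b B U hUn).trans hsum.le
      _ = 2 * traceNorm T := (two_mul _).symm
  exact (ENNReal.mul_le_mul_iff_right (by simp) (by simp)).1 h2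

theorem traceNorm_add_le (S T : H →L[ℂ] H) :
    traceNorm (S + T) ≤ traceNorm S + traceNorm T := by
  obtain ⟨V, hV, -, hVT⟩ := exists_polar (S + T)
  have hV' : ‖V.adjoint‖ ≤ 1 := by rwa [LinearIsometryEquiv.norm_map]
  refine le_trans ?_ (add_le_add (tsum_enorm_inner_le (stdBasis H) V.adjoint S hV')
    (tsum_enorm_inner_le (stdBasis H) V.adjoint T hV'))
  rw [← ENNReal.tsum_add]
  refine ENNReal.tsum_le_tsum fun i => ?_
  rw [← hVT, mul_add, _root_.add_apply, inner_add_right, Complex.add_re]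
  refine ENNReal.ofReal_add_le.trans (add_le_add ?_ ?_) <;>
  · rw [← ofReal_norm]
    exact ENNReal.ofReal_le_ofReal (Complex.re_le_norm _)

theorem traceNorm_smul (c : ℂ) (T : H →L[ℂ] H) : traceNorm (c • T) = ‖c‖ₑ * traceNorm T := by
  rw [traceNorm, traceNorm, CFC.abs_smul, ← ENNReal.tsum_mul_left]
  refine tsum_congr fun i => ?_
  rw [_root_.smul_apply, inner_smul_right_eq_smul, ← ofReal_norm,
    ← ENNReal.ofReal_mul (norm_nonneg _), Complex.smul_re, smul_eq_mul]

theorem traceNorm_zero : traceNorm (0 : H →L[ℂ] H) = 0 := by simp [traceNorm]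

theorem traceNorm_neg (T : H →L[ℂ] H) : traceNorm (-T) = traceNorm T := by
  simp [traceNorm]

variable (H) in
/-- The space of trace-class operators: the bounded operators `T` with `tr |T| < ∞`. -/
def TraceClass : Submodule ℂ (H →L[ℂ] H) where
  carrier := {T | traceNorm T < ∞}
  add_mem' {S T} hS hT := (traceNorm_add_le S T).trans_lt (ENNReal.add_lt_top.2 ⟨hS, hT⟩)
  zero_mem' := by simp [traceNorm_zero]
  smul_mem' c T hT := by
    change traceNorm (c • T) < ∞
    rw [traceNorm_smul]
    exact ENNReal.mul_lt_top enorm_lt_top hT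


instance : CoeFun (TraceClass H) fun _ => H → H := ⟨fun T => (T : H →L[ℂ] H)⟩

theorem opTrace_of_nonneg {P : H →L[ℂ] H} (hP : 0 ≤ P) :
    opTrace P = ((traceNorm P).toReal : ℂ) := by
  have h0 : ∀ x, 0 ≤ ⟪x, P x⟫_ℂ := fun x =>
    ((ContinuousLinearMap.nonneg_iff_isPositive P).1 hP).inner_nonneg_right x
  rw [traceNorm, CFC.abs_of_nonneg P hP, opTrace, ENNReal.tsum_toReal_eq (by simp),
    Complex.ofReal_tsum]
  refine tsum_congr fun i => ?_
  rw [ENNReal.toReal_ofReal (Complex.nonneg_iff.1 (h0 _)).1]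
  exact (Complex.eq_re_of_ofReal_le (h0 _))

theorem traceNorm_of_nonneg {ι : Type*} (b : HilbertBasis ι ℂ H) {P : H →L[ℂ] H} (hP : 0 ≤ P) :
    traceNorm P = ∑' i, ENNReal.ofReal (⟪b i, P (b i)⟫_ℂ).re := by
  rw [traceNorm, CFC.abs_of_nonneg P hP, posTrace_basis _ b hP]

/-! ### States and channels -/

variable (H) in
/-- A quantum state on `H`, given by its density operator: a positive trace-class operator of
trace one. -/
@[ext]
structure State where
  op : TraceClass H
  nonneg : 0 ≤ (op : H →L[ℂ] H)
  trace_one : opTrace (op : H →L[ℂ] H) = 1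

theorem State.traceNorm_eq (ρ : State H) : traceNorm (ρ.op : H →L[ℂ] H) = 1 := by
  have h := ρ.trace_one
  rw [opTrace_of_nonneg ρ.nonneg] at h
  have h' : (traceNorm (ρ.op : H →L[ℂ] H)).toReal = 1 := by exact_mod_cast h
  rwa [ENNReal.toReal_eq_one_iff] at h'

/-- The density operator given by a positive operator of trace norm one. -/
def State.mk' (P : H →L[ℂ] H) (h0 : 0 ≤ P) (h1 : traceNorm P = 1) : State H where
  op := ⟨P, by change traceNorm P < ∞; rw [h1]; exact ENNReal.one_lt_top⟩
  nonneg := h0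
  trace_one := by rw [opTrace_of_nonneg h0, h1]; simp

/-- The trace-norm distance `‖ρ - σ‖₁`. -/
def traceDist (ρ σ : State H) : ℝ≥0∞ :=
  traceNorm ((ρ.op : H →L[ℂ] H) - (σ.op : H →L[ℂ] H))

/-- States carry the trace norm topology. -/
instance : PseudoEMetricSpace (State H) where
  edist := traceDist
  edist_self ρ := by rw [traceDist, sub_self, traceNorm_zero]
  edist_comm ρ σ := by rw [traceDist, ← traceNorm_neg, neg_sub, traceDist]
  edist_triangle ρ σ τ := by
    rw [traceDist, ← sub_add_sub_cancel (ρ.op : H →L[ℂ] H) (σ.op : H →L[ℂ] H) (τ.op : H →L[ℂ] H)]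
    exact traceNorm_add_le _ _

variable (H K) in
/-- A quantum channel from `H` to `K` (Schrödinger picture): a completely positive and
trace-preserving linear map between the spaces of trace-class operators. Complete positivity says
that for every `n` the map applied entrywise sends positive `n × n` block operators on `Hⁿ` to
positive block operators on `Kⁿ`. -/
structure Channel where
  toLin : TraceClass H →ₗ[ℂ] TraceClass K
  completelyPositive : ∀ (n : ℕ) (ρ : Fin n → Fin n → TraceClass H),
    (∀ x : Fin n → H, 0 ≤ ∑ i, ∑ j, ⟪x i, ρ i j (x j)⟫_ℂ) →
    ∀ y : Fin n → K, 0 ≤ ∑ i, ∑ j, ⟪y i, toLin (ρ i j) (y j)⟫_ℂ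
  trace_map : ∀ ρ : TraceClass H,
    opTrace (toLin ρ : K →L[ℂ] K) = opTrace (ρ : H →L[ℂ] H)

namespace Channel

/-- The action of a channel on states. -/
def apply (E : Channel H K) (ρ : State H) : State K where
  op := E.toLin ρ.op
  nonneg := by
    rw [ContinuousLinearMap.nonneg_iff_isPositive, ContinuousLinearMap.isPositive_iff_complex]
    intro y
    have h := E.completelyPositive 1 (fun _ _ => ρ.op) (fun x => by
      simpa using ((ContinuousLinearMap.nonneg_iff_isPositive _).1 ρ.nonneg).inner_nonneg_right
        (x 0)) (fun _ => y)
    simp only [Finset.univ_unique, Finset.sum_const, Finset.card_singleton, one_smul] at h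
    obtain ⟨h1, h2⟩ := Complex.nonneg_iff.1 h
    rw [← inner_conj_symm]
    refine ⟨?_, ?_⟩
    · apply Complex.ext
      · simp only [RCLike.re_to_complex, Complex.ofReal_re]
      · simp only [Complex.ofReal_im, Complex.conj_im, ← h2, neg_zero]
    · rw [RCLike.re_to_complex, Complex.conj_re]
      exact h1
  trace_one := by rw [E.trace_map, ρ.trace_one]

variable (H) in
/-- The identity channel. -/
protected def id : Channel H H where
  toLin := LinearMap.id
  completelyPositive _ _ h := h
  trace_map _ := rfl

/-- Composition of channels, `F ∘ E`. -/
def comp {L : Type*} [NormedAddCommGroup L] [InnerProductSpace ℂ L] [CompleteSpace L]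
    (F : Channel K L) (E : Channel H K) : Channel H L where
  toLin := F.toLin ∘ₗ E.toLin
  completelyPositive n ρ h :=
    F.completelyPositive n (fun i j => E.toLin (ρ i j)) (E.completelyPositive n ρ h)
  trace_map ρ := (F.trace_map _).trans (E.trace_map ρ)

/-- `E` is the trace `ρ ↦ tr ρ` (the output space is meant to be one-dimensional, so that its
operators are the scalar multiples of the identity). -/
def IsTrace (E : Channel H K) : Prop :=
  ∀ ρ : TraceClass H, (E.toLin ρ : K →L[ℂ] K) = opTrace (ρ : H →L[ℂ] H) • (1 : K →L[ℂ] K)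

/-- `E` is the unitary channel `ρ ↦ U ρ U†`. -/
def Implements (E : Channel H K) (U : H ≃ₗᵢ[ℂ] K) : Prop :=
  ∀ (ρ : TraceClass H) (x : H), E.toLin ρ (U x) = U (ρ x)

/-- The bounded weak topology: the weakest topology making `E ↦ tr (E(T) M)` continuous for all
trace-class `T` on the input (the predual) and all bounded `M` on the output. -/
instance : TopologicalSpace (Channel H K) :=
  TopologicalSpace.induced
    (fun E (p : TraceClass H × (K →L[ℂ] K)) => opTrace ((E.toLin p.1 : K →L[ℂ] K) * p.2))
    Pi.topologicalSpace

end Channel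

/-! ### Hilbert space tensor products -/

variable (H K) in
/-- The Hilbert space tensor product: the completion of the algebraic tensor product. -/
abbrev HTensor := UniformSpace.Completion (H ⊗[ℂ] K)

/-- The product vector `x ⊗ y`. -/
def tvec (x : H) (y : K) : HTensor H K := ((x ⊗ₜ[ℂ] y : H ⊗[ℂ] K) : HTensor H K)

/-- The bounded operator `A ⊗ B`. -/
def opTensor (A : H →L[ℂ] H) (B : K →L[ℂ] K) : HTensor H K →L[ℂ] HTensor H K :=
  (TensorProduct.mapL A B).completion

theorem opTensor_tvec (A : H →L[ℂ] H) (B : K →L[ℂ] K) (x : H) (y : K) :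
    opTensor A B (tvec x y) = tvec (A x) (B y) := by
  simp [opTensor, tvec]

theorem inner_tvec (x x' : H) (y y' : K) :
    ⟪tvec x y, tvec x' y'⟫_ℂ = ⟪x, x'⟫_ℂ * ⟪y, y'⟫_ℂ := by
  simp [tvec]

/-- `x ⊗ y` as a continuous bilinear map. -/
def tvecL : H →L[ℂ] K →L[ℂ] HTensor H K :=
  (ContinuousLinearMap.compL ℂ K (H ⊗[ℂ] K) (HTensor H K)
    (UniformSpace.Completion.toComplL : H ⊗[ℂ] K →L[ℂ] HTensor H K)) ∘L TensorProduct.mkL ℂ H K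

theorem tvecL_apply (x : H) (y : K) : tvecL x y = tvec x y := rfl


theorem tvec_ext {z : HTensor H K} (h : ∀ x y, ⟪tvec x y, z⟫_ℂ = 0) : z = 0 := by
  have h1 : ∀ w : H ⊗[ℂ] K, ⟪(w : HTensor H K), z⟫_ℂ = 0 := by
    intro w
    induction w using TensorProduct.induction_on with
    | zero => rw [UniformSpace.Completion.coe_zero, inner_zero_left]
    | tmul x y => exact h x y
    | add a b ha hb => rw [UniformSpace.Completion.coe_add, inner_add_left, ha, hb, add_zero]
  have h2 : ∀ w : HTensor H K, ⟪w, z⟫_ℂ = 0 := fun w =>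
    UniformSpace.Completion.induction_on w (isClosed_eq (by fun_prop) (by fun_prop)) h1
  exact inner_self_eq_zero.1 (h2 z)

theorem basis_eq_zero {ι : Type*} (b : HilbertBasis ι ℂ H) (f : H →L[ℂ] ℂ)
    (h : ∀ i, f (b i) = 0) (x : H) : f x = 0 := by
  have hx := (b.hasSum_repr x).mapL f
  simp only [map_smul, h, smul_zero] at hx
  exact hx.unique hasSum_zero

/-- The product of two orthonormal bases is an orthonormal basis. -/
def tensorBasis {ι κ : Type*} (b : HilbertBasis ι ℂ H) (c : HilbertBasis κ ℂ K) :
    HilbertBasis (ι × κ) ℂ (HTensor H K) :=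
  HilbertBasis.mkOfOrthogonalEqBot (v := fun p : ι × κ => tvec (b p.1) (c p.2))
    (by
      classical
      rw [orthonormal_iff_ite]
      rintro ⟨i, j⟩ ⟨i', j'⟩
      rw [inner_tvec, orthonormal_iff_ite.1 b.orthonormal, orthonormal_iff_ite.1 c.orthonormal]
      simp [← ite_and, and_comm])
    (by
      rw [Submodule.eq_bot_iff]
      intro z hz
      have h0 : ∀ i j, ⟪z, tvec (b i) (c j)⟫_ℂ = 0 := fun i j =>
        (Submodule.mem_orthogonal' _ _).1 hz _ (Submodule.subset_span ⟨(i, j), rfl⟩)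
      have h1 : ∀ i y, ⟪z, tvec (b i) y⟫_ℂ = 0 := fun i =>
        basis_eq_zero c ((innerSL ℂ z) ∘L tvecL (b i)) (h0 i)
      have h2 : ∀ y x, ⟪z, tvec x y⟫_ℂ = 0 := fun y =>
        basis_eq_zero b ((innerSL ℂ z) ∘L tvecL.flip y) (fun i => h1 i y)
      exact tvec_ext fun x y => by rw [← inner_conj_symm, h2, map_zero])

theorem tensorBasis_apply {ι κ : Type*} (b : HilbertBasis ι ℂ H) (c : HilbertBasis κ ℂ K)
    (p : ι × κ) : tensorBasis b c p = tvec (b p.1) (c p.2) := by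
  rw [tensorBasis, HilbertBasis.coe_mkOfOrthogonalEqBot]

theorem opTensor_ext {S T : HTensor H K →L[ℂ] HTensor H K}
    (h : ∀ x y, S (tvec x y) = T (tvec x y)) : S = T := by
  ext z
  refine UniformSpace.Completion.induction_on z (isClosed_eq (by fun_prop) (by fun_prop)) ?_
  intro w
  induction w using TensorProduct.induction_on with
  | zero => rw [UniformSpace.Completion.coe_zero, map_zero, map_zero]
  | tmul x y => exact h x y
  | add a b ha hb => rw [UniformSpace.Completion.coe_add, map_add, map_add, ha, hb]

theorem opTensor_mul (A A' : H →L[ℂ] H) (B B' : K →L[ℂ] K) :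
    opTensor A B * opTensor A' B' = opTensor (A * A') (B * B') :=
  opTensor_ext fun x y => by simp only [mul_apply_eq_comp, opTensor_tvec]

theorem opTensor_adjoint (A : H →L[ℂ] H) (B : K →L[ℂ] K) :
    (opTensor A B).adjoint = opTensor A.adjoint B.adjoint :=
  opTensor_ext fun x y => by
    rw [← sub_eq_zero]
    refine tvec_ext fun x' y' => ?_
    rw [inner_sub_right, ContinuousLinearMap.adjoint_inner_right, opTensor_tvec, opTensor_tvec,
      inner_tvec, inner_tvec, ContinuousLinearMap.adjoint_inner_right,
      ContinuousLinearMap.adjoint_inner_right, sub_self]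

theorem opTensor_nonneg {A : H →L[ℂ] H} {B : K →L[ℂ] K} (hA : 0 ≤ A) (hB : 0 ≤ B) :
    0 ≤ opTensor A B := by
  have ha : IsSelfAdjoint (CFC.sqrt A) := IsSelfAdjoint.of_nonneg (CFC.sqrt_nonneg A)
  have hb : IsSelfAdjoint (CFC.sqrt B) := IsSelfAdjoint.of_nonneg (CFC.sqrt_nonneg B)
  have : opTensor A B
      = star (opTensor (CFC.sqrt A) (CFC.sqrt B)) * opTensor (CFC.sqrt A) (CFC.sqrt B) := by
    rw [ContinuousLinearMap.star_eq_adjoint, opTensor_adjoint, ha.adjoint_eq, hb.adjoint_eq,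
      opTensor_mul, CFC.sqrt_mul_sqrt_self A, CFC.sqrt_mul_sqrt_self B]
  rw [this]
  exact star_mul_self_nonneg (opTensor (CFC.sqrt A) (CFC.sqrt B))

theorem traceNorm_opTensor {A : H →L[ℂ] H} {B : K →L[ℂ] K} (hA : 0 ≤ A) (hB : 0 ≤ B) :
    traceNorm (opTensor A B) = traceNorm A * traceNorm B := by
  rw [traceNorm_of_nonneg (tensorBasis (stdBasis H) (stdBasis K)) (opTensor_nonneg hA hB),
    traceNorm_of_nonneg (stdBasis H) hA, traceNorm_of_nonneg (stdBasis K) hB, ENNReal.tsum_prod',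
    ← ENNReal.tsum_mul_right]
  refine tsum_congr fun i => ?_
  rw [← ENNReal.tsum_mul_left]
  refine tsum_congr fun j => ?_
  have h1 := Complex.nonneg_iff.1 (((ContinuousLinearMap.nonneg_iff_isPositive A).1
    hA).inner_nonneg_right (stdBasis H i))
  have h2 := Complex.nonneg_iff.1 (((ContinuousLinearMap.nonneg_iff_isPositive B).1
    hB).inner_nonneg_right (stdBasis K j))
  rw [tensorBasis_apply, opTensor_tvec, inner_tvec, Complex.mul_re, ← h1.2, zero_mul, sub_zero,
    ENNReal.ofReal_mul h1.1]

/-- The product state `ρ ⊗ σ`. -/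
def State.tensor (ρ : State H) (σ : State K) : State (HTensor H K) :=
  State.mk' (opTensor (ρ.op : H →L[ℂ] H) (σ.op : K →L[ℂ] K)) (opTensor_nonneg ρ.nonneg σ.nonneg)
    (by rw [traceNorm_opTensor ρ.nonneg σ.nonneg, ρ.traceNorm_eq, σ.traceNorm_eq, one_mul])

/-- The unique state `1` of the one-dimensional system `ℂ`. -/
def State.unit : State (EuclideanSpace ℂ PUnit.{u + 1}) :=
  State.mk' 1 zero_le_one (by
    rw [traceNorm_of_nonneg (EuclideanSpace.basisFun PUnit.{u + 1} ℂ).toHilbertBasis zero_le_one]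
    simp)

end TraceClass

/-! ### Quantum systems -/

/-- A complex Hilbert space (of arbitrary dimension). -/
structure HilbertSpace : Type (u + 1) where
  carrier : Type u
  [normed : NormedAddCommGroup carrier]
  [innerProd : InnerProductSpace ℂ carrier]
  [complete : CompleteSpace carrier]

attribute [instance] HilbertSpace.normed HilbertSpace.innerProd HilbertSpace.complete

instance : CoeSort HilbertSpace.{u} (Type u) := ⟨HilbertSpace.carrier⟩

/-- Quantum systems: the trivial system, the elementary systems, labelled by `ι`, and the
composite systems built from them. Labelling allows a resource theory to depend on more than the
Hilbert space (for instance on a division into parties) and to be formulated for a chosen class of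
systems (for instance for qutrits only); `ι` may also label all Hilbert spaces. -/
inductive QSystem (ι : Type v) : Type v
  | unit : QSystem ι
  | elem (i : ι) : QSystem ι
  | prod (A B : QSystem ι) : QSystem ι

namespace QSystem
variable {ι : Type v} (base : ι → HilbertSpace.{u})

/-- The Hilbert space of a system, given the Hilbert spaces of the elementary systems. The trivial
system is represented by the one-dimensional space `ℂ`, a composite one by the tensor product. -/
def space : QSystem ι → HilbertSpace.{u}
  | unit => ⟨EuclideanSpace ℂ PUnit.{u + 1}⟩
  | elem i => base i
  | prod A B => ⟨HTensor (space A) (space B)⟩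

/-- The system `A^{⊗ n}`, with `A^{⊗ 0}` the trivial system. -/
def pow (A : QSystem ι) : ℕ → QSystem ι
  | 0 => unit
  | n + 1 => prod (pow A n) A

variable {base}

/-- The product state `ρ ⊗ σ` of a composite system. -/
def tensorState {A B : QSystem ι} (ρ : State (A.space base)) (σ : State (B.space base)) :
    State ((prod A B).space base) :=
  State.tensor ρ σ

/-- The product vector `x ⊗ y` of a composite system. -/
def tensorVec {A B : QSystem ι} (x : A.space base) (y : B.space base) : (prod A B).space base :=
  tvec x y

/-- The state `ρ^{⊗ n}`, with `ρ^{⊗ 0} = 1`. -/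
def powState {A : QSystem ι} (ρ : State (A.space base)) : ∀ n : ℕ, State ((A.pow n).space base)
  | 0 => State.unit
  | n + 1 => tensorState (powState ρ n) ρ

/-- The scalar represented by a vector of the trivial system. -/
def unitCoord (x : (unit : QSystem ι).space base) : ℂ :=
  WithLp.ofLp (p := 2) (V := PUnit.{u + 1} → ℂ) x PUnit.unit

end QSystem

/-! ### Quantum resource theories -/

section Theory
variable {ι : Type v} {base : ι → HilbertSpace.{u}}

/-- `E` is the channel `M ⊗ N`: it acts on product states by `ρ ⊗ σ ↦ M(ρ) ⊗ N(σ)`, which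
determines it because product states span a dense subspace of the trace-class operators. -/
def IsTensorChannel {A B C D : QSystem ι}
    (M : Channel (A.space base) (C.space base)) (N : Channel (B.space base) (D.space base))
    (E : Channel ((A.prod B).space base) ((C.prod D).space base)) : Prop :=
  ∀ (ρ : State (A.space base)) (σ : State (B.space base)),
    E.apply (QSystem.tensorState ρ σ) = QSystem.tensorState (M.apply ρ) (N.apply σ)

variable (base) in
/-- A quantum resource theory: a compact set of states of interest for every system and a compact
set of free operations (channels mapping states of interest to states of interest) for every pair
of systems, closed under composition and tensor products and containing the identities and the
traces. The canonical identifications `(A ⊗ B) ⊗ C = A ⊗ (B ⊗ C)` and `ℂ ⊗ A = A = A ⊗ ℂ`, which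
are usually left implicit, count as doing nothing and hence are free in both directions. -/
structure QRT where
  /-- The set `S(A)` of states of interest. -/
  states : ∀ A : QSystem ι, Set (State (A.space base))
  isCompact_states : ∀ A, IsCompact (states A)
  /-- The set `O(A → B)` of free operations. -/
  free : ∀ A B : QSystem ι, Set (Channel (A.space base) (B.space base))
  isCompact_free : ∀ A B, IsCompact (free A B)
  mapsTo : ∀ {A B}, ∀ N ∈ free A B, ∀ ρ ∈ states A, N.apply ρ ∈ states B
  comp_mem : ∀ {A B C}, ∀ M ∈ free A B, ∀ N ∈ free B C, N.comp M ∈ free A C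
  tensor_mem : ∀ {A B C D}, ∀ M ∈ free A C, ∀ N ∈ free B D,
    ∃ E ∈ free (A.prod B) (C.prod D), IsTensorChannel M N E
  id_mem : ∀ A, Channel.id (A.space base) ∈ free A A
  trace_mem : ∀ A, ∃ E ∈ free A .unit, E.IsTrace
  assoc_mem : ∀ (A B C : QSystem ι)
    (U : ((A.prod B).prod C).space base ≃ₗᵢ[ℂ] (A.prod (B.prod C)).space base),
    (∀ x y z, U (QSystem.tensorVec (QSystem.tensorVec x y) z)
      = QSystem.tensorVec x (QSystem.tensorVec y z)) →
    (∃ E ∈ free _ _, E.Implements U) ∧ ∃ E ∈ free _ _, E.Implements U.symm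
  unit_prod_mem : ∀ (A : QSystem ι) (U : (QSystem.unit.prod A).space base ≃ₗᵢ[ℂ] A.space base),
    (∀ c x, U (QSystem.tensorVec c x) = QSystem.unitCoord c • x) →
    (∃ E ∈ free _ _, E.Implements U) ∧ ∃ E ∈ free _ _, E.Implements U.symm
  prod_unit_mem : ∀ (A : QSystem ι) (U : (A.prod .unit).space base ≃ₗᵢ[ℂ] A.space base),
    (∀ x c, U (QSystem.tensorVec x c) = QSystem.unitCoord c • x) →
    (∃ E ∈ free _ _, E.Implements U) ∧ ∃ E ∈ free _ _, E.Implements U.symm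

namespace QRT
variable (Q : QRT base)

/-- The preorder `φ ⪰ ψ`: some free operation converts `φ` exactly into `ψ`. -/
def Converts {A : QSystem ι} (φ ψ : State (A.space base)) : Prop :=
  ∃ N ∈ Q.free A A, N.apply φ = ψ

/-- The set `G(A)` of maximally resourceful states: the maximal elements of `S(A)`. -/
def maximal (A : QSystem ι) : Set (State (A.space base)) :=
  {φ | φ ∈ Q.states A ∧ ∀ ψ ∈ Q.states A, Q.Converts ψ φ → Q.Converts φ ψ}

/-- The asymptotically achievable rates: the `r ≥ 0` for which there are free operations
`Nₙ : A^{⊗ n} → B^{⊗ ⌈rn⌉}` with `liminf ‖Nₙ(φ^{⊗ n}) - ψ^{⊗ ⌈rn⌉}‖₁ = 0`. -/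
def achievable {A B : QSystem ι} (φ : State (A.space base)) (ψ : State (B.space base)) :
    Set ℝ≥0 :=
  {r | ∃ N : ∀ n : ℕ, Channel ((A.pow n).space base) ((B.pow ⌈r * n⌉₊).space base),
    (∀ n, N n ∈ Q.free (A.pow n) (B.pow ⌈r * n⌉₊)) ∧
    liminf (fun n => traceDist ((N n).apply (QSystem.powState φ n))
      (QSystem.powState ψ ⌈r * n⌉₊)) atTop = 0}

/-- The asymptotic state conversion rate `r_conv(φ → ψ)`, possibly infinite. -/
def rate {A B : QSystem ι} (φ : State (A.space base)) (ψ : State (B.space base)) : ℝ≥0∞ :=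
  ⨆ r ∈ Q.achievable φ ψ, (r : ℝ≥0∞)

/-- The distillable resource `inf_φ r_conv(ψ → φ) R_max`, where `0 · ∞ = 0`. -/
def distillable {A : QSystem ι} (Rmax : ℝ≥0) (ψ : State (A.space base)) : ℝ≥0∞ :=
  ⨅ φ ∈ Q.states A, Q.rate ψ φ * (Rmax : ℝ≥0∞)

/-- The resource cost `inf_φ R_max / r_conv(φ → ψ)`, where `c / 0 = ∞` for `c > 0` and
`c / ∞ = 0`. -/
def cost {A : QSystem ι} (Rmax : ℝ≥0) (ψ : State (A.space base)) : ℝ≥0∞ :=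
  ⨅ φ ∈ Q.states A, (Rmax : ℝ≥0∞) / Q.rate φ ψ

/-- A resource measure: a family of real functions on the sets `S(A)` that do not increase under
free operations. -/
structure ResourceMeasure where
  toFun : ∀ A : QSystem ι, Q.states A → ℝ
  monotone : ∀ {A B : QSystem ι} (N : Channel (A.space base) (B.space base))
    (hN : N ∈ Q.free A B) (ψ : Q.states A),
    toFun B ⟨N.apply ψ, Q.mapsTo N hN ψ ψ.2⟩ ≤ toFun A ψ

/-- A resource measure is consistent if `R(ψ) · r_conv(φ → ψ) ≤ R(φ)` for all states `ψ` and `φ` of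
any two systems (in the extended reals, where `0 · ∞ = 0`). -/
def ResourceMeasure.Consistent {Q : QRT base} (R : Q.ResourceMeasure) : Prop :=
  ∀ (A B : QSystem ι) (ψ : Q.states A) (φ : Q.states B),
    (R.toFun A ψ : EReal) * (Q.rate φ.1 ψ.1 : EReal) ≤ (R.toFun B φ : EReal)

end QRT

end Theory

end ResourceTheory

end

namespace ResourceTheory.QRT

open scoped ENNReal NNReal

variable {ι : Type v} {base : ι → HilbertSpace.{u}} {Q : QRT base}

/-! Both bounds are the consistency inequality R(target) · r_conv(source → target) ≤ R(source), read
once with a well-chosen target and once with an arbitrary source. Nothing about the asymptotic rate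
itself is needed: `rate` enters only as some number in [0, ∞].

For the distillable resource, take ψ as source and as target a state φ with R(φ) = Rmax. Consistency
gives Rmax · r_conv(ψ → φ) ≤ R(ψ), and the left side is one of the terms of the infimum R_D(ψ)
(`Consistent.distillable_le`).

For the cost, take ψ as target. Every source φ on the same system satisfies R(ψ) · r_conv(φ → ψ) ≤
R(φ) ≤ Rmax, so dividing by the rate gives R(ψ) ≤ Rmax / r_conv(φ → ψ), a lower bound for all terms
of the infimum R_C(ψ) (`Consistent.le_cost`). The only delicate point is this division when the rate
is 0 or ∞.

Consistency is an inequality in `EReal`, because a resource measure may be negative on other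
systems. On the system at hand it is nonnegative, so `Consistent.mul_rate_le` moves the inequality
to `ℝ≥0∞`, where R_D and R_C live. -/

/-- The consistency inequality in `ℝ≥0∞`, for states whose resource is given by nonnegative
reals. -/
theorem ResourceMeasure.Consistent.mul_rate_le {R : Q.ResourceMeasure} (hR : R.Consistent)
    {A B : QSystem ι} {ψ : Q.states A} {φ : Q.states B} {a b : ℝ≥0}
    (ha : R.toFun A ψ = a) (hb : R.toFun B φ = b) :
    (a : ℝ≥0∞) * Q.rate φ.1 ψ.1 ≤ b := by
  have h := hR A B ψ φ
  rw [ha, hb] at h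
  -- The embedding of `ℝ≥0∞` in `EReal` preserves order and products, 0 · ∞ = 0 included. The casts
  -- of `a` and `b` through `ℝ` and through `ℝ≥0∞` agree definitionally, so `h` closes the goal.
  exact EReal.coe_ennreal_le_coe_ennreal_iff.1 (by rw [EReal.coe_ennreal_mul]; exact h)

/-- The distillable resource is bounded by any consistent resource measure attaining the
normalization constant. -/
theorem ResourceMeasure.Consistent.distillable_le {R : Q.ResourceMeasure} (hR : R.Consistent)
    {A : QSystem ι} {ψ φ : Q.states A} {a Rmax : ℝ≥0}
    (ha : R.toFun A ψ = a) (hφ : R.toFun A φ = Rmax) :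
    Q.distillable Rmax ψ.1 ≤ a :=
  -- The roles in consistency are swapped here: `φ`, of value `Rmax`, is the target and `ψ` the
  -- source.
  (iInf₂_le φ.1 φ.2).trans ((mul_comm _ _).trans_le (hR.mul_rate_le hφ ha))

/-- The resource cost bounds any consistent resource measure with values in `[0, Rmax]`. -/
theorem ResourceMeasure.Consistent.le_cost {R : Q.ResourceMeasure} (hR : R.Consistent)
    {A : QSystem ι} {ψ : Q.states A} {a Rmax : ℝ≥0} (ha : R.toFun A ψ = a)
    (hbound : ∀ φ : Q.states A, 0 ≤ R.toFun A φ ∧ R.toFun A φ ≤ (Rmax : ℝ)) :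
    a ≤ Q.cost Rmax ψ.1 := by
  refine le_iInf₂ fun φ hφ => ?_
  -- The upper bound is applied to `ψ` itself, so that `a ≠ 0` will force `Rmax ≠ 0`.
  have haR : a ≤ Rmax := by exact_mod_cast ha ▸ (hbound ψ).2
  -- The chain passes through R(φ), made an element of `ℝ≥0` by its lower bound.
  have hb : (a : ℝ≥0∞) * Q.rate φ ψ.1 ≤ Rmax :=
    (hR.mul_rate_le (φ := ⟨φ, hφ⟩) (b := ⟨_, (hbound ⟨φ, hφ⟩).1⟩) ha rfl).trans
      (ENNReal.coe_le_coe.2 (hbound ⟨φ, hφ⟩).2)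
  -- The value 0 is split off because of the convention 0 / 0 = 0: with `Rmax = 0` and rate 0, `hb`
  -- holds for every `a`, while the quotient is 0.
  rcases eq_or_ne a 0 with rfl | h0
  · simp
  have hR0 : (Rmax : ℝ≥0∞) ≠ 0 := by simpa using ((pos_iff_ne_zero.2 h0).trans_le haR).ne'
  -- The two side conditions cover the degenerate rates: rate 0 is harmless since `Rmax ≠ 0` makes
  -- the quotient ∞, and rate ∞ is harmless since `Rmax` is finite, so that `hb` would then force `a
  -- = 0`.
  exact (ENNReal.le_div_iff_mul_le (Or.inr hR0) (Or.inr ENNReal.coe_ne_top)).2 hb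

end ResourceTheory.QRT

/-- The comparison takes place in `EReal`, which contains both the real values of R and the possibly
infinite R_D and R_C. -/
theorem corollary24 {ι : Type v} {base : ι → ResourceTheory.HilbertSpace.{u}}
    (Q : ResourceTheory.QRT base) (R : Q.ResourceMeasure) (hR : R.Consistent)
    (H : ResourceTheory.QSystem ι) (Rmax : NNReal)
    (hbound : ∀ ψ : Q.states H, 0 ≤ R.toFun H ψ ∧ R.toFun H ψ ≤ (Rmax : ℝ))
    (hattain : ∃ φ : Q.states H, φ.1 ∈ Q.maximal H ∧ R.toFun H φ = (Rmax : ℝ))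
    (ψ : Q.states H) :
    (Q.distillable Rmax ψ.1 : EReal) ≤ (R.toFun H ψ : EReal) ∧
      (R.toFun H ψ : EReal) ≤ (Q.cost Rmax ψ.1 : EReal) := by
  obtain ⟨φ, -, hφ⟩ := hattain
  -- Nonnegativity of R(ψ) turns both claims into inequalities between images of elements of `ℝ≥0∞`.
  lift R.toFun H ψ to NNReal using (hbound ψ).1 with a ha
  exact ⟨EReal.coe_ennreal_le_coe_ennreal_iff.2 (hR.distillable_le ha.symm hφ),
    EReal.coe_ennreal_le_coe_ennreal_iff.2 (hR.le_cost ha.symm hbound)⟩
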